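/- Let $D\subset\mathbb{C}$ be a Jordan domain, that is, a domain (nonempty connected open set) that is the interior region of a Jordan curve $J\subset\mathbb{C}$ (the bounded component of $\mathbb{C}\setminus J$, where $J$ is the image of the unit circle under an injective continuous map). Let $f$ be analytic on the closure $\overline{D}$, that is, on some open set containing $\overline{D}$. Then there are a polynomial $p\in\mathbb{C}[z]$ and an injective analytic map $\phi:D\to\mathbb{C}$ such that $f(z)=p(\phi(z))$ for all $z\in D$. -/

import Mathlib

/-- A Jordan curve in the plane: the image of the unit circle under a continuous injective map. -/
def IsJordanCurve (J : Set ℂ) : Prop :=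
  ∃ γ : Circle → ℂ, Continuous γ ∧ Function.Injective γ ∧ Set.range γ = J

/-- The interior region of a plane set `J`: the points off `J` whose connected component in the
complement of `J` is bounded. If `J` is a Jordan curve, this is the bounded component of the
complement of `J`. -/
def interiorRegion (J : Set ℂ) : Set ℂ :=
  {z | z ∉ J ∧ Bornology.IsBounded (connectedComponentIn Jᶜ z)}

/-- A Jordan domain: a domain (nonempty, open, connected) that is the interior region of
a Jordan curve. -/
def IsJordanDomain (D : Set ℂ) : Prop :=
  IsOpen D ∧ IsConnected D ∧ ∃ J : Set ℂ, IsJordanCurve J ∧ D = interiorRegion J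

open Filter Topology Set Metric MeasureTheory

/-! Let `K = closure D`. If `f'` vanishes identically near some point of `K`, then `f` is constant
on `D`. Otherwise `f' = q g` near `K`, with `q` a monic polynomial and `g` zero-free on `K`
(`AnalyticOnNhd.exists_factor`), and Hermite interpolation gives `f = T + q² h`. If a polynomial `P`
is close to `h` near `K`, then `p = T + q² P` is close to `f` and `p - f` is divisible by `q²`.

Look for `φ = z + q u`. Since `p'` is nearly `q g`, the expansion of `p (z + q u) - f z` has leading
terms `q² ((P - h) + g u)`, so after division by `q² g` the equation `p ∘ φ = f` becomes a fixed
point problem for a contraction, even at the critical points (`exists_comp_eq_of_contraction`). The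
solution `u` is small and holomorphic, so `φ` is close to the identity near `K`, hence injective on
`K` by the Schwarz lemma.

The polynomial `P` comes from Runge's theorem, which needs `Kᶜ` connected. Of the Jordan curve only
compactness and empty interior are used for this. For Runge, a cutoff and the Cauchy-Pompeiu formula
write `h` as a superposition of Cauchy kernels with poles in unbounded components off a thickening
of `K`; each kernel is a uniform limit of polynomials because passing to a closed subalgebra
enlarges a spectrum only by bounded components of its complement. -/

/-! ### Interpolation and factoring out zeros -/

/-- Hermite interpolation with remainder. -/
theorem AnalyticOnNhd.exists_polynomial_add_mul {K : Set ℂ} {F : ℂ → ℂ}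
    (hF : AnalyticOnNhd ℂ F K) (s : Multiset ℂ) :
    ∃ (T : Polynomial ℂ) (h : ℂ → ℂ), AnalyticOnNhd ℂ h K ∧
      ∀ z, F z = T.eval z + (s.map fun a => Polynomial.X - Polynomial.C a).prod.eval z * h z := by
  induction s using Multiset.induction with
  | empty => exact ⟨0, F, hF, fun z => by simp⟩
  | cons a s ih =>
    obtain ⟨T, h, hh, hT⟩ := ih
    -- Split `h z = h a + (z - a) * dslope h a z`; the constant term joins `T`.
    refine ⟨T + (s.map fun a => Polynomial.X - Polynomial.C a).prod * Polynomial.C (h a),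
      dslope h a, fun z hz => ?_, fun z => ?_⟩
    · rw [Complex.analyticAt_iff_eventually_differentiableAt]
      by_cases hza : z = a
      · subst hza
        have h1 := Complex.analyticAt_iff_eventually_differentiableAt.1 (hh z hz)
        obtain ⟨U, hU, hUo, hzU⟩ := _root_.eventually_nhds_iff.1 h1
        have h2 : DifferentiableOn ℂ (dslope h z) U :=
          (Complex.differentiableOn_dslope (hUo.mem_nhds hzU)).2
            fun w hw => (hU w hw).differentiableWithinAt
        filter_upwards [hUo.mem_nhds hzU] with w hw
        exact h2.differentiableAt (hUo.mem_nhds hw)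
      · filter_upwards [Complex.analyticAt_iff_eventually_differentiableAt.1 (hh z hz),
          isOpen_compl_singleton.mem_nhds hza] with w hw hwa
        exact (differentiableAt_dslope_of_ne hwa).2 hw
    · have := sub_smul_dslope h a z
      simp only [smul_eq_mul] at this
      simp only [Multiset.map_cons, Multiset.prod_cons, Polynomial.eval_add, Polynomial.eval_mul,
        Polynomial.eval_sub, Polynomial.eval_X, Polynomial.eval_C, hT z]
      linear_combination -(s.map fun a => Polynomial.X - Polynomial.C a).prod.eval z * this

/-- Zeros are divided out one point at a time; dividing by a power of `z - a` creates no zeros at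
the points already treated. `h0` makes every order of vanishing finite. -/
theorem AnalyticOnNhd.exists_factor_of_finset {K : Set ℂ} {F : ℂ → ℂ} (hF : AnalyticOnNhd ℂ F K)
    (h0 : ∀ z ∈ K, ¬ ∀ᶠ w in 𝓝 z, F w = 0) (S : Finset ℂ) (hS : ↑S ⊆ K) :
    ∃ (s : Multiset ℂ) (g : ℂ → ℂ), AnalyticOnNhd ℂ g K ∧ (∀ z ∈ S, g z ≠ 0) ∧
      ∀ z ∈ K, ∀ᶠ w in 𝓝 z,
        F w = (s.map fun a => Polynomial.X - Polynomial.C a).prod.eval w * g w := by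
  classical
  induction S using Finset.induction with
  | empty => exact ⟨0, F, hF, by simp, by simp⟩
  | insert a S ha ih =>
    rw [Finset.coe_insert, insert_subset_iff] at hS
    obtain ⟨s, g, hg, hgS, hfac⟩ := ih hS.2
    have hga : ¬ ∀ᶠ w in 𝓝 a, g w = 0 := fun h => h0 a hS.1 <| by
      filter_upwards [h, hfac a hS.1] with w h1 h2
      rw [h2, h1, mul_zero]
    obtain ⟨n, k, hk, hka, hgk⟩ := (hg a hS.1).exists_eventuallyEq_pow_smul_nonzero_iff.2 hga
    set g₁ : ℂ → ℂ := fun z => if z = a then k a else g z / (z - a) ^ n with hg₁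
    have e1 : g₁ =ᶠ[𝓝 a] k := by
      filter_upwards [hgk] with w hw
      by_cases hwa : w = a
      · simp [hg₁, hwa]
      · have : w - a ≠ 0 := sub_ne_zero.2 hwa
        simp [hg₁, hwa, hw]
        field_simp
    have e2 : ∀ z ≠ a, g₁ =ᶠ[𝓝 z] fun z => g z / (z - a) ^ n := fun z hz => by
      filter_upwards [isOpen_compl_singleton.mem_nhds hz] with w hw
      simp [hg₁, show w ≠ a from hw]
    refine ⟨s + Multiset.replicate n a, g₁, fun z hz => ?_, fun z hz => ?_, fun z hz => ?_⟩
    · by_cases hza : z = a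
      · subst hza; exact hk.congr e1.symm
      · refine AnalyticAt.congr ?_ (e2 z hza).symm
        exact (hg z hz).div (by fun_prop) (pow_ne_zero _ (sub_ne_zero.2 hza))
    · by_cases hza : z = a
      · subst hza; simpa [hg₁] using hka
      · have hzS : z ∈ S := (Finset.mem_insert.1 hz).resolve_left hza
        simpa [hg₁, hza, sub_eq_zero] using fun h => absurd h (hgS z hzS)
    · have e3 : ∀ᶠ w in 𝓝 z, g w = (w - a) ^ n * g₁ w := by
        by_cases hza : z = a
        · subst hza
          filter_upwards [hgk, e1] with w h1 h2
          rw [h1, h2, smul_eq_mul]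
        · filter_upwards [e2 z hza, isOpen_compl_singleton.mem_nhds hza] with w hw hwa
          have : w - a ≠ 0 := sub_ne_zero.2 hwa
          rw [hw]; field_simp
      filter_upwards [e3, hfac z hz] with w h1 h2
      simp [h2, h1, mul_assoc]

/-- A function analytic near a compact set and vanishing identically near none of its points is
the product of a monic polynomial and a function without zeros on the compact set. -/
theorem AnalyticOnNhd.exists_factor {K : Set ℂ} (hK : IsCompact K) {F : ℂ → ℂ}
    (hF : AnalyticOnNhd ℂ F K) (h0 : ∀ z ∈ K, ¬ ∀ᶠ w in 𝓝 z, F w = 0) :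
    ∃ (s : Multiset ℂ) (g : ℂ → ℂ), AnalyticOnNhd ℂ g K ∧ (∀ z ∈ K, g z ≠ 0) ∧
      ∀ z ∈ K, ∀ᶠ w in 𝓝 z,
        F w = (s.map fun a => Polynomial.X - Polynomial.C a).prod.eval w * g w := by
  have hfin : (K ∩ F ⁻¹' {0}).Finite := by
    by_contra hinf
    obtain ⟨x, hxK, hx⟩ := Set.Infinite.exists_accPt_of_subset_isCompact hinf hK inter_subset_left
    rw [accPt_iff_frequently_nhdsNE] at hx
    exact h0 x hxK ((hF x hxK).frequently_zero_iff_eventually_zero.1 (hx.mono fun y hy => hy.2))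
  obtain ⟨s, g, hg, hgS, hfac⟩ := hF.exists_factor_of_finset h0 hfin.toFinset (by simp)
  refine ⟨s, g, hg, fun z hz hgz => ?_, hfac⟩
  refine hgS z ?_ hgz
  simp [hz, (hfac z hz).self_of_nhds, hgz]

/-! ### Solving `p ∘ φ = f` by contraction -/

/-- Fixed points of a holomorphic family of contractions depend holomorphically on the parameter. -/
theorem exists_differentiableOn_fixedPoint {U : Set ℂ} (hU : IsOpen U) {Φ : ℂ → ℂ → ℂ} {r : ℝ}
    (hr : 0 ≤ r)
    (hd : ∀ u : ℂ → ℂ, DifferentiableOn ℂ u U → DifferentiableOn ℂ (fun z => Φ z (u z)) U)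
    (h0 : ∀ z ∈ U, ‖Φ z 0‖ ≤ r / 2)
    (hl : ∀ z ∈ U, ∀ v w, ‖v‖ ≤ r → ‖w‖ ≤ r → ‖Φ z v - Φ z w‖ ≤ ‖v - w‖ / 2) :
    ∃ u : ℂ → ℂ, DifferentiableOn ℂ u U ∧ (∀ z ∈ U, ‖u z‖ ≤ r) ∧ ∀ z ∈ U, Φ z (u z) = u z := by
  set s : ℕ → ℂ → ℂ := fun n z => (Φ z)^[n] 0 with hs
  have s0 : ∀ z, s 0 z = 0 := fun z => rfl
  have ss : ∀ n z, s (n + 1) z = Φ z (s n z) := fun n z => Function.iterate_succ_apply' _ _ _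
  have hb : ∀ n, ∀ z ∈ U, ‖s n z‖ ≤ r := by
    intro n z hz
    induction n with
    | zero => simpa [s0] using hr
    | succ n ih =>
      rw [ss]
      have h1 := hl z hz (s n z) 0 ih (by simpa using hr)
      rw [sub_zero] at h1
      have h2 := norm_add_le (Φ z (s n z) - Φ z 0) (Φ z 0)
      rw [sub_add_cancel] at h2
      linarith [h0 z hz]
  have hsd : ∀ n, DifferentiableOn ℂ (s n) U := by
    intro n
    induction n with
    | zero => exact differentiableOn_const 0
    | succ n ih => exact (hd _ ih).congr fun z _ => ss n z
  have hst : ∀ n, ∀ z ∈ U, dist (s n z) (s (n + 1) z) ≤ r / 2 / 2 ^ n := by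
    intro n z hz
    induction n with
    | zero => simpa [ss, s0, dist_eq_norm] using h0 z hz
    | succ n ih =>
      have h1 := hl z hz (s n z) (s (n + 1) z) (hb n z hz) (hb (n + 1) z hz)
      rw [← ss, ← ss, ← dist_eq_norm, ← dist_eq_norm] at h1
      calc _ ≤ _ := h1
        _ ≤ r / 2 / 2 ^ n / 2 := by gcongr
        _ = _ := by rw [pow_succ]; ring
  have hlim : ∀ z, ∃ a, z ∈ U → Tendsto (fun n => s n z) atTop (𝓝 a) := by
    intro z
    by_cases hz : z ∈ U
    · obtain ⟨a, ha⟩ := cauchySeq_tendsto_of_complete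
        (cauchySeq_of_le_geometric_two fun n => hst n z hz)
      exact ⟨a, fun _ => ha⟩
    · exact ⟨0, fun h => absurd h hz⟩
  choose u hu using hlim
  have hdist : ∀ n, ∀ z ∈ U, dist (s n z) (u z) ≤ r / 2 ^ n := fun n z hz =>
    dist_le_of_le_geometric_two_of_tendsto (fun n => hst n z hz) (hu z hz) n
  have hto : Tendsto (fun n : ℕ => r / 2 ^ n) atTop (𝓝 0) :=
    tendsto_const_nhds.div_atTop (tendsto_pow_atTop_atTop_of_one_lt one_lt_two)
  have hunif : TendstoUniformlyOn s u atTop U := by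
    rw [Metric.tendstoUniformlyOn_iff]
    intro ε hε
    filter_upwards [hto.eventually (gt_mem_nhds hε)] with n hn z hz
    rw [dist_comm]
    exact (hdist n z hz).trans_lt hn
  have hub : ∀ z ∈ U, ‖u z‖ ≤ r := fun z hz =>
    le_of_tendsto (hu z hz).norm (Eventually.of_forall fun n => hb n z hz)
  refine ⟨u, hunif.tendstoLocallyUniformlyOn.differentiableOn
    (Eventually.of_forall hsd) hU, hub, fun z hz => ?_⟩
  refine tendsto_nhds_unique (f := fun n => s (n + 1) z) ?_ ((hu z hz).comp (tendsto_add_atTop_nat 1))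
  rw [tendsto_iff_norm_sub_tendsto_zero]
  refine squeeze_zero (fun _ => norm_nonneg _) (fun n => ?_) hto
  rw [ss]
  have h1 := hl z hz (s n z) (u z) (hb n z hz) (hub z hz)
  have h2 := hdist n z hz
  rw [dist_eq_norm] at h2
  linarith [norm_nonneg (s n z - u z)]

/-- A holomorphic map that is close to the identity near a set is injective on the set. -/
theorem injOn_of_norm_sub_id_le {K : Set ℂ} {φ : ℂ → ℂ} {ρ d : ℝ} (hρ : 0 < ρ) (hd : 4 * d ≤ ρ)
    (hφ : DifferentiableOn ℂ φ (thickening ρ K)) (hb : ∀ z ∈ thickening ρ K, ‖φ z - z‖ ≤ d) :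
    InjOn φ K := by
  intro z hz w hw h
  have hzw := hb z (self_subset_thickening hρ K hz)
  have hww := hb w (self_subset_thickening hρ K hw)
  by_contra hne
  have hpos : 0 < dist w z := dist_pos.2 (Ne.symm hne)
  have hd0 : 0 ≤ d := (norm_nonneg _).trans hzw
  -- If `φ z = φ w`, then `φ - id` preserves the distance of `z` and `w`, while the Schwarz lemma
  -- makes it contract by `2 * d / ρ ≤ 1 / 2`.
  have key : dist (φ w - w) (φ z - z) = dist w z := by
    rw [h, dist_eq_norm, dist_eq_norm, ← norm_neg]; congr 1; ring
  have hle : dist w z ≤ 2 * d := by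
    rw [← key, dist_eq_norm]
    linarith [norm_sub_le (φ w - w) (φ z - z)]
  have hball : ball z ρ ⊆ thickening ρ K := ball_subset_thickening hz ρ
  have := Complex.dist_le_div_mul_dist_of_mapsTo_ball (f := fun x => φ x - x) (c := z) (z := w)
    (R₁ := ρ) (R₂ := 2 * d) ((hφ.mono hball).sub differentiableOn_id)
    (fun x hx => by
      rw [mem_closedBall, dist_eq_norm]
      linarith [norm_sub_le (φ x - x) (φ z - z), hb x (hball hx)])
    (by rw [mem_ball]; linarith)
  simp only [key] at this
  have h2 : 2 * d / ρ ≤ 1 / 2 := by rw [div_le_iff₀ hρ]; linarith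
  nlinarith

theorem IsCompact.exists_one_le_norm_bound {K : Set ℂ} (hK : IsCompact K) {F : ℂ → ℂ}
    (hF : ContinuousOn F K) : ∃ M : ℝ, 1 ≤ M ∧ ∀ z ∈ K, ‖F z‖ ≤ M := by
  obtain ⟨C, hC⟩ := hK.exists_bound_of_continuousOn hF
  exact ⟨max 1 C, le_max_left _ _, fun z hz => (hC z hz).trans (le_max_right _ _)⟩

/-- Estimate for the derivative of the contraction, with `ζ = z + q z * w`, `κ = q ζ / q z`, `G = g
z`, `G' = g ζ` and `E` the error from `p - f`. The first two terms add up to `3 * M² * r ≤ m / 4`,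
whence the factor 12. -/
theorem norm_mul_add_sub_le_half {κ G G' E : ℂ} {M m r : ℝ} (hM : 1 ≤ M) (hm : m ≤ 1) (hr : 0 ≤ r)
    (hκ : ‖κ - 1‖ ≤ M * r) (hG' : ‖G'‖ ≤ M) (hGG : ‖G' - G‖ ≤ M * (M * r)) (hE : ‖E‖ ≤ m / 4)
    (hMr : 12 * (M * M * r) ≤ m) : ‖κ * (G' + E) - G‖ ≤ m / 2 := by
  have e : κ * (G' + E) - G = (κ - 1) * (G' + E) + (G' - G) + E := by ring
  have h1 : ‖(κ - 1) * (G' + E)‖ ≤ M * r * (M + M) := by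
    rw [norm_mul]
    have : ‖G' + E‖ ≤ M + M := (norm_add_le _ _).trans (by linarith)
    gcongr
  rw [e]
  calc _ ≤ ‖(κ - 1) * (G' + E)‖ + ‖G' - G‖ + ‖E‖ := norm_add₃_le
    _ ≤ M * r * (M + M) + M * (M * r) + m / 4 := by gcongr
    _ ≤ m / 2 := by linarith

theorem norm_sub_le_of_closedBall {F : ℂ → ℂ} {z v : ℂ} {ρ M : ℝ}
    (hF : ∀ w ∈ closedBall z ρ, DifferentiableAt ℂ F w) (hM : ∀ w ∈ closedBall z ρ, ‖deriv F w‖ ≤ M)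
    (hv : ‖v‖ ≤ ρ) : ‖F (z + v) - F z‖ ≤ M * ‖v‖ := by
  have := (convex_closedBall z ρ).norm_image_sub_le_of_norm_deriv_le hF hM
    (mem_closedBall_self ((norm_nonneg v).trans hv)) (y := z + v) (by simpa using hv)
  simpa using this

/-- If `p` approximates `f` on a neighbourhood `V` of `K`, with an error divisible by the square of
a polynomial `q` which accounts for all critical points of `f`, then `f = p ∘ φ` for some `φ` close
to the identity. -/
theorem exists_comp_eq_of_contraction {V : Set ℂ} (hV : IsOpen V) {f g : ℂ → ℂ}
    {p q : Polynomial ℂ} (hq : q ≠ 0) {M m r : ℝ} (hr : 0 < r) (hm : 0 < m)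
    (hf : DifferentiableOn ℂ f V) (hg : DifferentiableOn ℂ g V) (hgm : ∀ z ∈ V, m ≤ ‖g z‖)
    (hqM : ∀ z ∈ V, ‖q.eval z‖ ≤ M)
    (hpf : ∀ z ∈ V, ‖p.eval z - f z‖ ≤ ‖q.eval z‖ ^ 2 * (m * r / 2))
    (hder : ∀ z ∈ V, q.eval z ≠ 0 → ∀ w, ‖w‖ ≤ r →
      ‖p.derivative.eval (z + q.eval z * w) / q.eval z - g z‖ ≤ m / 2) :
    ∃ φ : ℂ → ℂ, DifferentiableOn ℂ φ V ∧ (∀ z ∈ V, ‖φ z - z‖ ≤ M * r) ∧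
      ∀ z ∈ V, f z = p.eval (φ z) := by
  classical
  set U : Set ℂ := V ∩ {z | q.eval z ≠ 0} with hU
  have hUo : IsOpen U := hV.inter (isOpen_ne_fun q.continuous continuous_const)
  -- A simplified Newton map: `q² g` stands in for the `w`-derivative `p' (z + q w) * q`.
  set Φ : ℂ → ℂ → ℂ := fun z w =>
    w - (p.eval (z + q.eval z * w) - f z) / (q.eval z ^ 2 * g z) with hΦ
  have hgU : ∀ z ∈ V, g z ≠ 0 := fun z hz h => by
    have := hgm z hz
    rw [h, norm_zero] at this
    linarith
  obtain ⟨u, hu, hur, hfix⟩ := exists_differentiableOn_fixedPoint (Φ := Φ) hUo hr.le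
    (fun u hu => by
      refine hu.sub (((p.differentiable.comp_differentiableOn
        (differentiableOn_id.add (q.differentiable.differentiableOn.mul hu))).sub
        (hf.mono inter_subset_left)).div
        ((q.differentiable.differentiableOn.pow 2).mul (hg.mono inter_subset_left)) ?_)
      exact fun z hz => mul_ne_zero (pow_ne_zero _ hz.2) (hgU z hz.1))
    (fun z hz => by
      have h1 := hpf z hz.1
      have h2 := hgm z hz.1
      have h3 : 0 < ‖q.eval z‖ := norm_pos_iff.2 hz.2
      simp only [hΦ, mul_zero, add_zero, zero_sub, norm_neg, norm_div, norm_mul, norm_pow]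
      rw [div_le_iff₀ (mul_pos (by positivity) (hm.trans_le h2))]
      calc _ ≤ _ := h1
        _ = r / 2 * (‖q.eval z‖ ^ 2 * m) := by ring
        _ ≤ _ := by gcongr)
    (fun z hz v w hv hw => by
      have hd : ∀ x : ℂ, HasDerivAt (Φ z)
          (1 - p.derivative.eval (z + q.eval z * x) * q.eval z / (q.eval z ^ 2 * g z)) x := fun x => by
        have h1 : HasDerivAt (fun x => z + q.eval z * x) (q.eval z) x := by
          simpa using ((hasDerivAt_id x).const_mul (q.eval z)).const_add z
        exact (hasDerivAt_id x).sub
          ((((p.hasDerivAt _).comp x h1).sub_const (f z)).div_const (q.eval z ^ 2 * g z))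
      have := (convex_closedBall (0 : ℂ) r).norm_image_sub_le_of_norm_hasDerivWithin_le
        (fun x _ => (hd x).hasDerivWithinAt) (C := 1 / 2) (fun x hx => ?_)
        (mem_closedBall_zero_iff.2 hw) (mem_closedBall_zero_iff.2 hv)
      · linarith
      · have hgz := hgU z hz.1
        have hqz : q.eval z ≠ 0 := hz.2
        have e : 1 - p.derivative.eval (z + q.eval z * x) * q.eval z / (q.eval z ^ 2 * g z) =
            -((p.derivative.eval (z + q.eval z * x) / q.eval z - g z) / g z) := by
          field_simp; ring
        rw [e, norm_neg, norm_div, div_le_iff₀ (norm_pos_iff.2 hgz)]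
        linarith [hder z hz.1 hqz x (mem_closedBall_zero_iff.1 hx), hgm z hz.1])
  -- The default 0 makes the bound `hle` hold everywhere; at zeros of `q` the value of `u` is
  -- irrelevant.
  set φ : ℂ → ℂ := fun z => z + q.eval z * (if z ∈ U then u z else 0) with hφ
  have hφU : ∀ z ∈ U, φ z = z + q.eval z * u z := fun z hz => by simp [hφ, hz]
  have hφ0 : ∀ z, q.eval z = 0 → φ z = z := fun z hz => by simp [hφ, hz]
  have hle : ∀ z, ‖φ z - z‖ ≤ ‖q.eval z‖ * r := fun z => by
    simp only [hφ, add_sub_cancel_left, norm_mul]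
    gcongr
    split_ifs with h
    · exact hur z h
    · simpa using hr.le
  have hdU : DifferentiableOn ℂ φ U :=
    (differentiableOn_id.add (q.differentiable.differentiableOn.mul hu)).congr hφU
  refine ⟨φ, fun z hz => ?_, fun z hz => (hle z).trans (by gcongr; exact hqM z hz), fun z hz => ?_⟩
  · by_cases hqz : q.eval z = 0
    · have hzeros : ∀ᶠ w in 𝓝 z, w ∈ V ∧ (w ≠ z → q.eval w ≠ 0) := by
        refine Filter.Eventually.and (hV.mem_nhds hz) ?_
        have hfin : (q.roots.toFinset.erase z : Set ℂ).Finite := Finset.finite_toSet _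
        filter_upwards [hfin.isClosed.isOpen_compl.mem_nhds (by simp)] with w hw hwz h
        simp [hwz, hq, h] at hw
      obtain ⟨ε, hε, hball⟩ := Metric.eventually_nhds_iff_ball.1 hzeros
      refine DifferentiableAt.differentiableWithinAt ?_
      -- Removable singularity: `φ` is continuous at `z` because `‖φ w - w‖ ≤ ‖q w‖ * r` tends to 0.
      refine ((Complex.differentiableOn_compl_singleton_and_continuousAt_iff
        (ball_mem_nhds z hε)).1 ⟨?_, ?_⟩).differentiableAt (ball_mem_nhds z hε)
      · exact hdU.mono fun w hw => ⟨(hball w hw.1).1, (hball w hw.1).2 hw.2⟩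
      · have h1 : Tendsto (fun w => φ w - w) (𝓝 z) (𝓝 0) := by
          refine squeeze_zero_norm hle ?_
          have : ContinuousAt (fun w => ‖q.eval w‖ * r) z := by fun_prop
          simpa [ContinuousAt, hqz] using this
        have h2 := h1.add (tendsto_id (x := 𝓝 z))
        simp only [id, sub_add_cancel, zero_add] at h2
        rwa [ContinuousAt, hφ0 z hqz]
    · exact (hdU.differentiableAt (hUo.mem_nhds ⟨hz, hqz⟩)).differentiableWithinAt
  · by_cases hqz : q.eval z = 0
    · have := hpf z hz
      rw [hqz, norm_zero, zero_pow two_ne_zero, zero_mul] at this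
      rw [hφ0 z hqz, eq_comm, ← sub_eq_zero, ← norm_le_zero_iff]
      exact this
    · have h1 := hfix z ⟨hz, hqz⟩
      simp only [hΦ, sub_eq_self, div_eq_zero_iff] at h1
      rw [hφU z ⟨hz, hqz⟩, eq_comm, ← sub_eq_zero]
      exact h1.resolve_right (mul_ne_zero (pow_ne_zero _ hqz) (hgU z hz))

/-- The constants are fixed in the order `ρ`, `M` and `m`, `r`, `δ`; only then is the approximant
`P` chosen, so its size never enters. -/
theorem exists_polynomial_comp_eq_of_approx {K : Set ℂ} (hK : IsCompact K) {f g h : ℂ → ℂ}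
    {q T : Polynomial ℂ} (hq : q ≠ 0) (hf : AnalyticOnNhd ℂ f K) (hg : AnalyticOnNhd ℂ g K)
    (hh : AnalyticOnNhd ℂ h K) (hg0 : ∀ z ∈ K, g z ≠ 0)
    (hfac : ∀ z ∈ K, ∀ᶠ w in 𝓝 z, deriv f w = q.eval w * g w)
    (hdiv : ∀ z, f z = T.eval z + q.eval z ^ 2 * h z)
    {ε : ℝ} (hε : 0 < ε)
    (happ : ∀ δ > 0, ∃ P : Polynomial ℂ, ∀ z ∈ cthickening ε K, ‖P.eval z - h z‖ ≤ δ) :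
    ∃ (p : Polynomial ℂ) (φ : ℂ → ℂ),
      AnalyticOnNhd ℂ φ K ∧ InjOn φ K ∧ ∀ z ∈ K, f z = p.eval (φ z) := by
  set W : Set ℂ := {z | AnalyticAt ℂ f z} ∩ {z | AnalyticAt ℂ g z} ∩ {z | AnalyticAt ℂ h z} ∩
    {z | ∀ᶠ w in 𝓝 z, g w ≠ 0} ∩ {z | ∀ᶠ w in 𝓝 z, deriv f w = q.eval w * g w} with hW
  have hWo : IsOpen W := ((((isOpen_analyticAt ℂ f).inter (isOpen_analyticAt ℂ g)).inter
    (isOpen_analyticAt ℂ h)).inter isOpen_setOfPred_eventually_nhds).inter isOpen_setOfPred_eventually_nhds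
  have hKW : K ⊆ W := fun z hz =>
    ⟨⟨⟨⟨hf z hz, hg z hz⟩, hh z hz⟩, (hg z hz).continuousAt.eventually_ne (hg0 z hz)⟩, hfac z hz⟩
  obtain ⟨R, hR, hRW⟩ := hK.exists_cthickening_subset_open hWo hKW
  -- Three layers: `z` ranges within `ρ` of `K`, `z + q z * w` within `2 * ρ`, and Cauchy's estimate
  -- for the derivative of the error there reaches `3 * ρ`.
  obtain ⟨ρ, hρ, hρR, hρε⟩ : ∃ ρ > 0, 3 * ρ ≤ R ∧ 3 * ρ ≤ ε :=
    ⟨min R ε / 3, by positivity, by linarith [min_le_left R ε], by linarith [min_le_right R ε]⟩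
  set N := cthickening (3 * ρ) K with hN
  have hNc : IsCompact N := hK.cthickening
  have hNW : N ⊆ W := (cthickening_mono hρR K).trans hRW
  have hfN : AnalyticOnNhd ℂ f N := fun z hz => (hNW hz).1.1.1.1
  have hgN : AnalyticOnNhd ℂ g N := fun z hz => (hNW hz).1.1.1.2
  have hhN : AnalyticOnNhd ℂ h N := fun z hz => (hNW hz).1.1.2
  have hg0N : ∀ z ∈ N, g z ≠ 0 := fun z hz => (hNW hz).1.2.self_of_nhds
  have hfacN : ∀ z ∈ N, deriv f z = q.eval z * g z := fun z hz => (hNW hz).2.self_of_nhds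
  obtain ⟨M₁, hM₁, hqM₁⟩ := hNc.exists_one_le_norm_bound q.continuous.continuousOn
  obtain ⟨M₂, hM₂, hqM₂⟩ := hNc.exists_one_le_norm_bound q.derivative.continuous.continuousOn
  obtain ⟨M₃, hM₃, hgM₃⟩ := hNc.exists_one_le_norm_bound hgN.continuousOn
  obtain ⟨M₄, hM₄, hgM₄⟩ := hNc.exists_one_le_norm_bound hgN.deriv.continuousOn
  obtain ⟨M₅, hM₅, hgM₅⟩ := hNc.exists_one_le_norm_bound (hgN.continuousOn.inv₀ hg0N)
  set M := M₁ + M₂ + M₃ + M₄ with hM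
  have hM1 : 1 ≤ M := by linarith
  replace hqM₁ : ∀ z ∈ N, ‖q.eval z‖ ≤ M := fun z hz => (hqM₁ z hz).trans (by linarith)
  replace hqM₂ : ∀ z ∈ N, ‖q.derivative.eval z‖ ≤ M := fun z hz => (hqM₂ z hz).trans (by linarith)
  replace hgM₃ : ∀ z ∈ N, ‖g z‖ ≤ M := fun z hz => (hgM₃ z hz).trans (by linarith)
  replace hgM₄ : ∀ z ∈ N, ‖deriv g z‖ ≤ M := fun z hz => (hgM₄ z hz).trans (by linarith)
  set m := M₅⁻¹ with hm
  have hm0 : 0 < m := by positivity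
  have hm1 : m ≤ 1 := inv_le_one_of_one_le₀ hM₅
  have hgm : ∀ z ∈ N, m ≤ ‖g z‖ := fun z hz => by
    have := hgM₅ z hz
    rw [Pi.inv_apply, norm_inv] at this
    exact inv_le_of_inv_le₀ (norm_pos_iff.2 (hg0N z hz)) this
  -- The first bound serves injectivity and keeps the shifts below `ρ`; the second serves the
  -- contraction.
  obtain ⟨r, hr, hMρ, hMr⟩ : ∃ r > 0, 4 * (M * r) ≤ ρ ∧ 12 * (M * M * r) ≤ m := by
    refine ⟨min (ρ / (4 * M)) (m / (12 * (M * M))), by positivity, ?_, ?_⟩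
    · have := min_le_left (ρ / (4 * M)) (m / (12 * (M * M)))
      rw [le_div_iff₀ (by positivity)] at this
      linarith
    · have := min_le_right (ρ / (4 * M)) (m / (12 * (M * M)))
      rw [le_div_iff₀ (by positivity)] at this
      linarith
  -- The first bound controls `Φ z 0`, the second the error `2 q' e + q e'` in the derivative.
  obtain ⟨δ, hδ, hδr, hδm⟩ : ∃ δ > 0, δ ≤ m * r / 2 ∧ 2 * (M * δ) + M * (δ / ρ) ≤ m / 4 := by
    refine ⟨min (m * r / 2) (m / (4 * (2 * M + M / ρ))), by positivity, min_le_left _ _, ?_⟩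
    have := min_le_right (m * r / 2) (m / (4 * (2 * M + M / ρ)))
    rw [le_div_iff₀ (by positivity)] at this
    calc _ = min (m * r / 2) (m / (4 * (2 * M + M / ρ))) * (4 * (2 * M + M / ρ)) / 4 := by ring
      _ ≤ _ := by linarith
  obtain ⟨P, hP⟩ := happ δ hδ
  replace hP : ∀ z ∈ N, ‖P.eval z - h z‖ ≤ δ := fun z hz => hP z (cthickening_mono hρε K hz)
  set e : ℂ → ℂ := fun z => P.eval z - h z with he
  set p := T + q ^ 2 * P with hp
  have heN : ∀ z ∈ N, HasDerivAt e (deriv e z) z := fun z hz =>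
    ((P.differentiable z).sub (hhN z hz).differentiableAt).hasDerivAt
  have hpf : ∀ z, p.eval z - f z = q.eval z ^ 2 * e z := fun z => by
    rw [hdiv z]; simp [hp, he]; ring
  have hball : ∀ {a b : ℝ}, 0 ≤ a → 0 ≤ b → a + b ≤ 3 * ρ → ∀ z ∈ cthickening a K,
      closedBall z b ⊆ N := fun {a b} ha hb hab z hz =>
    (closedBall_subset_cthickening hz b).trans
      ((cthickening_cthickening_subset hb ha K).trans (cthickening_mono (by linarith) K))
  have hder_e : ∀ z ∈ cthickening (2 * ρ) K, ‖deriv e z‖ ≤ δ / ρ := fun z hz => by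
    have hb := hball (by positivity) hρ.le (by linarith) z hz
    refine Complex.norm_deriv_le_of_forall_mem_sphere_norm_le hρ ⟨fun w hw => ?_, fun w hw => ?_⟩
      fun w hw => hP w (hb (sphere_subset_closedBall hw))
    · exact (heN w (hb (ball_subset_closedBall hw))).differentiableAt.differentiableWithinAt
    · rw [closure_ball z hρ.ne'] at hw
      exact (heN w (hb hw)).continuousAt.continuousWithinAt
  -- Because the error is `q² e`, its derivative keeps a factor `q`, matching `f' = q g`.
  have hder_p : ∀ z ∈ N, p.derivative.eval z = q.eval z *
      (g z + (2 * q.derivative.eval z * e z + q.eval z * deriv e z)) := fun z hz => by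
    have h1 : HasDerivAt (fun z => p.eval z) (deriv f z +
        (2 * q.eval z * q.derivative.eval z * e z + q.eval z ^ 2 * deriv e z)) z := by
      have h2 := (hfN z hz).differentiableAt.hasDerivAt.add
        (((q.hasDerivAt z).pow 2).mul (heN z hz))
      refine (h2.congr_deriv (by simp)).congr_of_eventuallyEq (Eventually.of_forall fun w => ?_)
      have := hpf w
      simp only [Pi.add_apply, Pi.mul_apply, Pi.pow_apply]
      linear_combination this
    rw [(p.hasDerivAt z).unique h1, hfacN z hz]
    ring
  set V := thickening ρ K with hV
  have hVN : V ⊆ N := (thickening_subset_cthickening ρ K).trans (cthickening_mono (by linarith) K)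
  obtain ⟨φ, hφ, hφid, hφp⟩ := exists_comp_eq_of_contraction (p := p) (g := g) (f := f) (M := M)
    isOpen_thickening hq hr hm0 (hfN.differentiableOn.mono hVN) (hgN.differentiableOn.mono hVN)
    (fun z hz => hgm z (hVN hz)) (fun z hz => hqM₁ z (hVN hz))
    (fun z hz => by
      rw [hpf, norm_mul, norm_pow]
      gcongr
      exact (hP z (hVN hz)).trans hδr)
    (fun z hz hqz w hw => by
      have hzc : z ∈ cthickening ρ K := thickening_subset_cthickening ρ K hz
      have hb := hball hρ.le hρ.le (by linarith) z hzc
      have hv : ‖q.eval z * w‖ ≤ M * r := by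
        rw [norm_mul]
        exact mul_le_mul (hqM₁ z (hVN hz)) hw (norm_nonneg _) (by linarith)
      have hvρ : ‖q.eval z * w‖ ≤ ρ := by nlinarith [norm_nonneg (q.eval z * w)]
      have hmem : z + q.eval z * w ∈ cthickening (2 * ρ) K :=
        cthickening_mono (by linarith) K (cthickening_cthickening_subset hρ.le hρ.le K
          (closedBall_subset_cthickening hzc ρ (by simpa using hvρ)))
      have hmemN : z + q.eval z * w ∈ N := cthickening_mono (by linarith) K hmem
      have h1 := norm_sub_le_of_closedBall (F := fun x => q.eval x) (M := M)
        (fun x _ => q.differentiable x)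
        (fun x hx => by rw [q.deriv]; exact hqM₂ x (hb hx)) hvρ
      have h2 := norm_sub_le_of_closedBall (F := g) (M := M)
        (fun x hx => (hgN x (hb hx)).differentiableAt) (fun x hx => hgM₄ x (hb hx)) hvρ
      rw [hder_p _ hmemN, mul_div_right_comm]
      refine norm_mul_add_sub_le_half hM1 hm1 hr.le ?_ (hgM₃ _ hmemN)
        (h2.trans (by gcongr)) ?_ hMr
      -- The shift `q z * w` carries the factor `q z`, which cancels the denominator of `κ`.
      · rw [← div_self hqz, ← sub_div, norm_div, div_le_iff₀ (norm_pos_iff.2 hqz)]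
        calc _ ≤ _ := h1
          _ = M * ‖w‖ * ‖q.eval z‖ := by rw [norm_mul]; ring
          _ ≤ _ := by gcongr
      · refine le_trans ?_ hδm
        refine (norm_add_le _ _).trans ?_
        simp only [norm_mul, Complex.norm_ofNat, mul_assoc]
        have := hder_e _ hmem
        gcongr
        · exact hqM₂ _ hmemN
        · exact hP _ hmemN
        · exact hqM₁ _ hmemN)
  have hKV : K ⊆ V := self_subset_thickening hρ K
  exact ⟨p, φ, fun z hz => hφ.analyticAt (isOpen_thickening.mem_nhds (hKV hz)),
    injOn_of_norm_sub_id_le hρ hMρ hφ hφid, fun z hz => hφp z (hKV hz)⟩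

/-! ### Plane topology of Jordan domains -/

theorem isPreconnected_setOf_lt_norm {R : ℝ} (hR : 0 < R) : IsPreconnected {z : ℂ | R < ‖z‖} := by
  have h : {z : ℂ | R < ‖z‖} = Complex.exp '' {w | Real.log R < w.re} := by
    ext z
    constructor
    · intro hz
      have hz0 : z ≠ 0 := norm_pos_iff.1 (hR.trans hz)
      exact ⟨Complex.log z, by simpa [Complex.log_re] using Real.log_lt_log hR hz,
        Complex.exp_log hz0⟩
    · rintro ⟨w, hw, rfl⟩
      rw [mem_ofPred_eq, Complex.norm_exp, ← Real.exp_log hR]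
      exact Real.exp_lt_exp.2 hw
  rw [h]
  exact (convex_halfSpace_re_gt _).isPreconnected.image _ Complex.continuous_exp.continuousOn

/-- The complement of a compact set in the plane has only one unbounded component. -/
theorem IsCompact.isPreconnected_setOf_not_isBounded {J : Set ℂ} (hJ : IsCompact J) :
    ∃ R > 0, {z | R < ‖z‖} ⊆ {z | z ∉ J ∧ ¬ Bornology.IsBounded (connectedComponentIn Jᶜ z)} ∧
      IsPreconnected {z | z ∉ J ∧ ¬ Bornology.IsBounded (connectedComponentIn Jᶜ z)} := by
  obtain ⟨R, hR, hJR⟩ := hJ.isBounded.subset_closedBall_lt 0 0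
  have hsub : {z : ℂ | R < ‖z‖} ⊆ Jᶜ := fun z hz hzJ => by
    have := hJR hzJ
    rw [mem_closedBall_zero_iff] at this
    exact absurd hz (not_lt.2 this)
  have hunb : ¬ Bornology.IsBounded {z : ℂ | R < ‖z‖} := fun h => by
    refine NormedSpace.unbounded_univ ℝ ℂ ((h.union (isBounded_closedBall (x := 0) (r := R))).subset ?_)
    intro z _
    rcases lt_or_ge R ‖z‖ with h | h
    · exact Or.inl h
    · exact Or.inr (by simpa using h)
  have hout : {z : ℂ | R < ‖z‖} ⊆ {z | z ∉ J ∧ ¬ Bornology.IsBounded (connectedComponentIn Jᶜ z)} :=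
    fun z hz => ⟨hsub hz, fun hb => hunb (hb.subset
      ((isPreconnected_setOf_lt_norm hR).subset_connectedComponentIn hz hsub))⟩
  refine ⟨R, hR, hout, ?_⟩
  set x₀ : ℂ := ((R + 1 : ℝ) : ℂ) with hx₀
  have hx₀R : R < ‖x₀‖ := by
    rw [hx₀, Complex.norm_real, Real.norm_of_nonneg (by linarith)]; linarith
  suffices h : {z | z ∉ J ∧ ¬ Bornology.IsBounded (connectedComponentIn Jᶜ z)} =
      connectedComponentIn Jᶜ x₀ by
    rw [h]; exact isPreconnected_connectedComponentIn
  ext z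
  constructor
  · rintro ⟨hz, hb⟩
    have : ¬ connectedComponentIn Jᶜ z ⊆ closedBall 0 R := fun h => hb (isBounded_closedBall.subset h)
    obtain ⟨y, hy, hyR⟩ := not_subset.1 this
    rw [mem_closedBall_zero_iff, not_le] at hyR
    have h1 : y ∈ connectedComponentIn Jᶜ x₀ :=
      (isPreconnected_setOf_lt_norm hR).subset_connectedComponentIn hx₀R hsub hyR
    rw [connectedComponentIn_eq h1, ← connectedComponentIn_eq hy]
    exact mem_connectedComponentIn hz
  · intro hz
    exact ⟨connectedComponentIn_subset _ _ hz, by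
      rw [← connectedComponentIn_eq hz]; exact (hout hx₀R).2⟩

/-- There is no continuous injection from an open disc minus a point to the real line. -/
theorem not_injOn_ball_diff_singleton {c a : ℂ} {ε : ℝ} (hε : 0 < ε) {ψ : ℂ → ℝ}
    (hc : ContinuousOn ψ (ball c ε \ {a})) : ¬ InjOn ψ (ball c ε \ {a}) := by
  intro hi
  -- The plane minus a countable set is connected; transport this to the disc by a homeomorphism.
  have hconn : ∀ s : Set ℂ, s.Countable → IsPreconnected (ball c ε \ s) := fun s hs => by
    set e := OpenPartialHomeomorph.univBall c ε
    have het : e.target = ball c ε := OpenPartialHomeomorph.univBall_target c hε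
    have hes : e.source = univ := OpenPartialHomeomorph.univBall_source c ε
    have hei : InjOn e univ := hes ▸ e.injOn
    have h1 : ball c ε \ s = e '' (e ⁻¹' s)ᶜ := by
      rw [← preimage_compl, image_preimage_eq_inter_range, ← image_univ, ← hes,
        e.image_source_eq_target, het, inter_comm, sdiff_eq]
    rw [h1]
    exact ((hs.preimage_of_injOn (hei.mono (subset_univ _))).isConnected_compl_of_one_lt_rank
      (by simp)).isPreconnected.image _
      (OpenPartialHomeomorph.continuous_univBall c ε).continuousOn
  have hinf : (ball c ε \ {a}).Infinite :=
    (infinite_of_mem_nhds c (ball_mem_nhds c hε)).sdiff (finite_singleton a)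
  obtain ⟨x, hx, y, hy, hxy⟩ : ∃ x ∈ ball c ε \ {a}, ∃ y ∈ ball c ε \ {a}, ψ x < ψ y := by
    obtain ⟨x, hx, y, hy, hxy⟩ := hinf.nontrivial
    rcases lt_or_gt_of_ne (hi.ne hx hy hxy) with h | h
    exacts [⟨x, hx, y, hy, h⟩, ⟨y, hy, x, hx, h⟩]
  obtain ⟨t, ht⟩ := exists_between hxy
  have h1 := (hconn {a} (countable_singleton a)).image ψ hc
  obtain ⟨b, hb, rfl⟩ := h1.Icc_subset (mem_image_of_mem ψ hx) (mem_image_of_mem ψ hy)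
    (Ioo_subset_Icc_self ht)
  -- Deleting `b` as well leaves a connected set, on which `ψ` must take the intermediate value `ψ
  -- b` again.
  have hsub : ball c ε \ {a, b} ⊆ ball c ε \ {a} := sdiff_subset_sdiff_right (by simp)
  have h2 := (hconn {a, b} (by simp)).image ψ (hc.mono hsub)
  obtain ⟨d, hd, hdb⟩ := h2.Icc_subset
    (mem_image_of_mem ψ ⟨hx.1, by
      simp only [mem_insert_iff, mem_singleton_iff, not_or]
      exact ⟨hx.2, fun h => by simp [h] at ht⟩⟩)
    (mem_image_of_mem ψ ⟨hy.1, by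
      simp only [mem_insert_iff, mem_singleton_iff, not_or]
      exact ⟨hy.2, fun h => by simp [h] at ht⟩⟩) (Ioo_subset_Icc_self ht)
  exact hd.2 (by simp [hi (hsub hd) hb hdb])

theorem IsJordanCurve.isCompact {J : Set ℂ} (hJ : IsJordanCurve J) : IsCompact J := by
  obtain ⟨γ, hγ, -, rfl⟩ := hJ
  exact isCompact_range hγ

/-- Otherwise the inverse of `γ`, followed by an angle coordinate on the circle minus a point, would
embed a punctured disc in the line. -/
theorem IsJordanCurve.interior_eq_empty {J : Set ℂ} (hJ : IsJordanCurve J) : interior J = ∅ := by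
  obtain ⟨γ, hγ, hinj, rfl⟩ := hJ
  by_contra hne
  obtain ⟨c, hc⟩ := nonempty_iff_ne_empty.2 hne
  obtain ⟨ε, hε, hball⟩ := Metric.isOpen_iff.1 isOpen_interior c hc
  replace hball : ball c ε ⊆ range γ := hball.trans interior_subset
  obtain ⟨x₀, rfl⟩ := hball (mem_ball_self hε)
  have hemb : IsClosedEmbedding γ := hγ.isClosedEmbedding hinj
  -- The minus sign puts the branch cut of `arg` at `x₀`, whose image is the removed point.
  set ψ : ℂ → ℝ := fun z => Complex.arg (-(Function.invFun γ z / x₀ : Circle) : ℂ) with hψ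
  have hinv : ContinuousOn (Function.invFun γ) (range γ) := by
    rintro _ ⟨x, rfl⟩
    rw [hemb.isInducing.continuousWithinAt_iff]
    have hg : ∀ y ∈ range γ, γ (Function.invFun γ y) = y := fun y hy => Function.invFun_eq hy
    exact continuousWithinAt_id.congr hg (hg _ ⟨x, rfl⟩)
  refine not_injOn_ball_diff_singleton (c := γ x₀) (a := γ x₀) hε (ψ := ψ) ?_ ?_
  · rintro z ⟨hz, hza⟩
    have h1 : ContinuousWithinAt (Function.invFun γ) (ball (γ x₀) ε \ {γ x₀}) z :=
      (hinv z (hball hz)).mono (sdiff_subset.trans hball)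
    have h2 : ContinuousWithinAt (fun z => (-(Function.invFun γ z / x₀ : Circle) : ℂ))
        (ball (γ x₀) ε \ {γ x₀}) z :=
      (continuous_neg.comp (continuous_subtype_val.comp
        (continuous_id.div_const x₀))).continuousAt.comp_continuousWithinAt h1
    refine (Complex.continuousAt_arg ?_).comp_continuousWithinAt h2
    rw [Complex.mem_slitPlane_iff_arg]
    refine ⟨fun h => hza ?_, by simp⟩
    rw [Complex.arg_eq_pi_iff, Complex.neg_re, Complex.neg_im, neg_lt_zero, neg_eq_zero] at h
    have h3 := Circle.arg_eq_zero.1 (Complex.arg_eq_zero_iff.2 ⟨h.1.le, h.2⟩)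
    rw [mem_singleton_iff, ← Function.invFun_eq (hball hz), div_eq_one.1 h3]
  · rintro z hz w hw h
    simp only [hψ] at h
    have h1 := Complex.ext_norm_arg (by rw [norm_neg, norm_neg, Circle.norm_coe, Circle.norm_coe]) h
    rw [neg_inj, Circle.coe_inj, div_left_inj] at h1
    rw [← Function.invFun_eq (hball hz.1), h1, Function.invFun_eq (hball hw.1)]

theorem IsJordanDomain.isBounded {D : Set ℂ} (hD : IsJordanDomain D) : Bornology.IsBounded D := by
  obtain ⟨-, -, J, hJ, rfl⟩ := hD
  obtain ⟨R, hR, hsub, -⟩ := hJ.isCompact.isPreconnected_setOf_not_isBounded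
  refine isBounded_closedBall (x := 0) (r := R) |>.subset fun z hz => ?_
  rw [mem_closedBall_zero_iff]
  by_contra h
  exact (hsub (not_le.1 h)).2 hz.2

/-- The set lies between the unbounded component of `Jᶜ` and its closure: a point off `closure D` is
either in that component or on `J`, and `J` has empty interior. -/
theorem IsJordanDomain.isPreconnected_compl_closure {D : Set ℂ} (hD : IsJordanDomain D) :
    IsPreconnected (closure D)ᶜ := by
  obtain ⟨hDo, -, J, hJ, rfl⟩ := hD
  obtain ⟨-, -, -, hU⟩ := hJ.isCompact.isPreconnected_setOf_not_isBounded
  have hUo : IsOpen {z | z ∉ J ∧ ¬ Bornology.IsBounded (connectedComponentIn Jᶜ z)} := by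
    have hJo := hJ.isCompact.isClosed.isOpen_compl
    refine isOpen_iff_mem_nhds.2 fun z hz => ?_
    filter_upwards [hJo.connectedComponentIn.mem_nhds (mem_connectedComponentIn hz.1)] with w hw
    exact ⟨connectedComponentIn_subset _ _ hw, by rw [← connectedComponentIn_eq hw]; exact hz.2⟩
  refine hU.subset_closure ?_ fun z hz => ?_
  · have : Disjoint {z | z ∉ J ∧ ¬ Bornology.IsBounded (connectedComponentIn Jᶜ z)}
        (closure (interiorRegion J)) :=
      Disjoint.closure_right (disjoint_left.2 fun z hz hz' => hz.2 hz'.2) hUo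
    exact this.subset_compl_right
  · rw [_root_.mem_closure_iff]
    intro o ho hzo
    have h1 : IsOpen (o ∩ (closure (interiorRegion J))ᶜ) := ho.inter isClosed_closure.isOpen_compl
    have h2 : ¬ o ∩ (closure (interiorRegion J))ᶜ ⊆ J := fun h => by
      have := interior_maximal h h1 ⟨hzo, hz⟩
      rw [hJ.interior_eq_empty] at this
      exact this
    obtain ⟨y, hy, hyJ⟩ := not_subset.1 h2
    exact ⟨y, hy.1, hyJ, fun hb => hy.2 (subset_closure ⟨hyJ, hb⟩)⟩

/-! ### The Cauchy-Pompeiu formula -/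

theorem integral_inv_add_real {k : ℂ} (hk : k.im ≠ 0) (a b : ℝ) :
    ∫ x in a..b, ((x : ℂ) + k)⁻¹ = Complex.log (b + k) - Complex.log (a + k) := by
  have hne : ∀ x : ℝ, (x : ℂ) + k ∈ Complex.slitPlane := fun x => Or.inr (by simpa using hk)
  refine intervalIntegral.integral_eq_sub_of_hasDerivAt (f := fun x : ℝ => Complex.log (x + k))
    (fun x _ => ?_) (ContinuousOn.intervalIntegrable fun x _ => ?_)
  · have := ((Complex.hasDerivAt_log (hne x)).comp (x : ℂ)
      ((hasDerivAt_id (x : ℂ)).add_const k)).comp_ofReal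
    simpa using this
  · have := Complex.slitPlane_ne_zero (hne x)
    exact ContinuousAt.continuousWithinAt (by fun_prop (disch := assumption))

/-- The factor `σ` turns the vertical segment away from the slit of `log`; it is `-1` on the left
side of the square. -/
theorem I_mul_integral_inv_add_mul_I {k σ : ℂ} {c d : ℝ}
    (hσ : ∀ y : ℝ, σ * (k + y * Complex.I) ∈ Complex.slitPlane) :
    Complex.I * ∫ y in c..d, (k + y * Complex.I)⁻¹ =
      Complex.log (σ * (k + d * Complex.I)) - Complex.log (σ * (k + c * Complex.I)) := by
  have hne : ∀ x : ℝ, σ ≠ 0 ∧ k + x * Complex.I ≠ 0 := fun x =>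
    mul_ne_zero_iff.1 (Complex.slitPlane_ne_zero (hσ x))
  rw [← intervalIntegral.integral_const_mul]
  refine intervalIntegral.integral_eq_sub_of_hasDerivAt
    (f := fun x : ℝ => Complex.log (σ * (k + x * Complex.I)))
    (fun x _ => ?_) (ContinuousOn.intervalIntegrable fun x _ => ?_)
  · have h1 : HasDerivAt (fun x : ℂ => σ * (k + x * Complex.I)) (σ * Complex.I) x := by
      simpa using (((hasDerivAt_id (x : ℂ)).mul_const Complex.I).const_add k).const_mul σ
    refine ((Complex.hasDerivAt_log (hσ x)).comp (x : ℂ) h1).comp_ofReal.congr_deriv ?_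
    have := (hne x).1
    have := (hne x).2
    field_simp
  · have := (hne x).2
    exact ContinuousAt.continuousWithinAt (by fun_prop (disch := assumption))

/-- The integral of `1 / (z - w)` along the boundary of a square around `w`. -/
theorem integral_boundary_square_sub_inv {R : ℝ} {w : ℂ} (hre : |w.re| < R) (him : |w.im| < R) :
    (∫ x in (-R)..R, ((x : ℂ) + ((-R : ℝ) : ℂ) * Complex.I - w)⁻¹) -
      (∫ x in (-R)..R, ((x : ℂ) + (R : ℂ) * Complex.I - w)⁻¹) +
      Complex.I * (∫ y in (-R)..R, ((R : ℂ) + y * Complex.I - w)⁻¹) -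
      Complex.I * (∫ y in (-R)..R, (((-R : ℝ) : ℂ) + y * Complex.I - w)⁻¹) =
      2 * Real.pi * Complex.I := by
  rw [abs_lt] at hre him
  have e1 : ∀ x k : ℂ, x + k - w = x + (k - w) := fun x k => by ring
  have e2 : ∀ x k : ℂ, x + k - w = (x - w) + k := fun x k => by ring
  rw [show (∫ x in (-R)..R, ((x : ℂ) + ((-R : ℝ) : ℂ) * Complex.I - w)⁻¹) = _ by
      simp only [e1]; exact integral_inv_add_real (by simp; linarith) _ _,
    show (∫ x in (-R)..R, ((x : ℂ) + (R : ℂ) * Complex.I - w)⁻¹) = _ by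
      simp only [e1]; exact integral_inv_add_real (by simp; linarith) _ _,
    show Complex.I * (∫ y in (-R)..R, ((R : ℂ) + y * Complex.I - w)⁻¹) = _ by
      simp only [e2]
      exact I_mul_integral_inv_add_mul_I (σ := 1) (fun y => Or.inl (by simp; linarith)),
    show Complex.I * (∫ y in (-R)..R, (((-R : ℝ) : ℂ) + y * Complex.I - w)⁻¹) = _ by
      simp only [e2]
      exact I_mul_integral_inv_add_mul_I (σ := -1) (fun y => Or.inl (by simp; linarith))]
  -- Using `log (-ζ)` on the left side costs `-πi` at the upper corner and `+πi` at the lower one;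
  -- together they give `2πi`.
  have l1 : ∀ x : ℂ, 0 < x.im → Complex.log (-1 * x) = Complex.log x - Real.pi * Complex.I := by
    intro x hx
    rw [neg_one_mul, Complex.log, Complex.log, norm_neg, Complex.arg_neg_eq_arg_sub_pi_of_im_pos hx]
    push_cast; ring
  have l2 : ∀ x : ℂ, x.im < 0 → Complex.log (-1 * x) = Complex.log x + Real.pi * Complex.I := by
    intro x hx
    rw [neg_one_mul, Complex.log, Complex.log, norm_neg, Complex.arg_neg_eq_arg_add_pi_of_im_neg hx]
    push_cast; ring
  rw [l1 _ (by simp; linarith), l2 _ (by simp; linarith)]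
  simp only [one_mul, ← e1, ← e2]
  ring

/-- Twice `I` times the Wirtinger derivative with respect to the conjugate variable. -/
noncomputable def dbar (F : ℂ → ℂ) (z : ℂ) : ℂ :=
  Complex.I * fderiv ℝ F z 1 - fderiv ℝ F z Complex.I

theorem ContDiff.continuous_dbar {F : ℂ → ℂ} (hF : ContDiff ℝ 1 F) : Continuous (dbar F) := by
  have := hF.continuous_fderiv one_ne_zero
  unfold dbar
  fun_prop

theorem DifferentiableAt.dbar_eq_zero {F : ℂ → ℂ} {z : ℂ} (hF : DifferentiableAt ℂ F z) :
    dbar F z = 0 := by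
  rw [dbar, (hF.hasFDerivAt.restrictScalars ℝ).fderiv]
  simp only [ContinuousLinearMap.coe_restrictScalars']
  rw [← smul_eq_mul, ← map_smul, smul_eq_mul, mul_one, sub_self]

/-- The Cauchy-Pompeiu formula for a compactly supported function, at points near which the function
is holomorphic. -/
theorem integral_dbar_mul_sub_inv {F : ℂ → ℂ} (hF : ContDiff ℝ 1 F) {R : ℝ}
    (hsupp : ∀ z, F z ≠ 0 → |z.re| < R ∧ |z.im| < R) {w : ℂ} (hre : |w.re| < R) (him : |w.im| < R)
    (hw : AnalyticAt ℂ F w) :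
    ∫ x in (-R)..R, ∫ y in (-R)..R,
        dbar F (x + y * Complex.I) * ((x : ℂ) + y * Complex.I - w)⁻¹ =
      -(2 * Real.pi * Complex.I * F w) := by
  have hd : ∀ z, HasFDerivAt F (fderiv ℝ F z) z := fun z =>
    (hF.differentiable one_ne_zero z).hasFDerivAt
  have hcont : Continuous fun z => dbar F z * (z - w)⁻¹ := by
    refine continuous_iff_continuousAt.2 fun z => ?_
    by_cases hz : z = w
    · subst hz
      refine (continuousAt_const (y := (0 : ℂ))).congr ?_
      filter_upwards [Complex.analyticAt_iff_eventually_differentiableAt.1 hw] with y hy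
      rw [hy.dbar_eq_zero, zero_mul]
    · exact hF.continuous_dbar.continuousAt.mul
        ((continuousAt_id.sub continuousAt_const).inv₀ (sub_ne_zero.2 hz))
  set f' : ℂ → ℂ →L[ℝ] ℂ := fun z =>
    (z - w)⁻¹ • fderiv ℝ F z - ((z - w)⁻¹ ^ 2 * (F z - F w)) • ContinuousLinearMap.id ℝ ℂ with hf'
  have hf'e : ∀ z, Complex.I • f' z 1 - f' z Complex.I = dbar F z * (z - w)⁻¹ := fun z => by
    simp [hf', dbar]; ring
  -- Green's formula is applied to `dslope F w`, which is continuous at `w`. Its `dbar` off `w` is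
  -- that of `F z / (z - w)`, and on the boundary, where `F = 0`, it equals `-F w / (z - w)`.
  have key := Complex.integral_boundary_rect_of_hasFDerivAt_real_off_countable
    (dslope F w) f' ⟨-R, -R⟩ ⟨R, R⟩ {w} (countable_singleton w) (fun z _ => ?_) (fun z hz => ?_) ?_
  · simp only [hf'e] at key
    rw [← key]
    have hout : ∀ z, ¬ (|z.re| < R ∧ |z.im| < R) → dslope F w z = -F w * (z - w)⁻¹ := fun z hz => by
      have hzw : z ≠ w := fun h => hz (h ▸ ⟨hre, him⟩)
      have h0 : F z = 0 := by
        by_contra h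
        exact hz (hsupp z h)
      rw [dslope_of_ne _ hzw, slope_def_field, h0]
      ring
    have hR : |R| = R := abs_of_pos ((abs_nonneg _).trans_lt hre)
    have i1 : ∀ x : ℝ, dslope F w (x + ((-R : ℝ) : ℂ) * Complex.I) =
        -F w * ((x : ℂ) + ((-R : ℝ) : ℂ) * Complex.I - w)⁻¹ := fun x => hout _ (by simp [hR])
    have i2 : ∀ x : ℝ, dslope F w (x + (R : ℂ) * Complex.I) =
        -F w * ((x : ℂ) + (R : ℂ) * Complex.I - w)⁻¹ := fun x => hout _ (by simp [hR])
    have i3 : ∀ y : ℝ, dslope F w ((R : ℂ) + y * Complex.I) =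
        -F w * ((R : ℂ) + y * Complex.I - w)⁻¹ := fun x => hout _ (by simp [hR])
    have i4 : ∀ y : ℝ, dslope F w (((-R : ℝ) : ℂ) + y * Complex.I) =
        -F w * (((-R : ℝ) : ℂ) + y * Complex.I - w)⁻¹ := fun x => hout _ (by simp [hR])
    simp only [i1, i2, i3, i4, intervalIntegral.integral_const_mul, smul_eq_mul]
    linear_combination -(F w) * integral_boundary_square_sub_inv hre him
  · by_cases hz : z = w
    · subst hz
      exact (continuousAt_dslope_same.2 hw.differentiableAt).continuousWithinAt
    · exact ((continuousAt_dslope_of_ne hz).2 hF.continuous.continuousAt).continuousWithinAt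
  · have hzw : z ≠ w := hz.2
    have h1 : HasFDerivAt (fun z : ℂ => (z - w)⁻¹)
        ((-((z - w) ^ 2)⁻¹) • ContinuousLinearMap.id ℝ ℂ) z := by
      have := ((hasDerivAt_id z).sub_const w).inv (sub_ne_zero.2 hzw)
      refine (this.hasFDerivAt.restrictScalars ℝ).congr_fderiv ?_
      ext; simp; ring
    have h2 := h1.mul ((hd z).sub_const (F w))
    refine (h2.congr_fderiv ?_).congr_of_eventuallyEq ?_
    · ext; simp [hf']; ring
    · filter_upwards [isOpen_compl_singleton.mem_nhds hzw] with y hy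
      rw [dslope_of_ne _ hy, slope_def_field, Pi.mul_apply]
      ring
  · simp only [hf'e]
    exact hcont.continuousOn.integrableOn_compact (isCompact_uIcc.reProdIm isCompact_uIcc)

/-! ### Runge's theorem -/

/-- A path in `Kᶜ` from a point of `L` to a far point has positive distance from `K`, so it avoids a
small thickening; compactness of `L` makes `ε` uniform. -/
theorem IsCompact.exists_cthickening_not_isBounded {K L : Set ℂ} (hK : IsCompact K)
    (hKc : IsPreconnected Kᶜ) (hL : IsCompact L) (hLK : L ⊆ Kᶜ) {ε₀ : ℝ} (hε₀ : 0 < ε₀) :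
    ∃ ε > 0, ε ≤ ε₀ ∧ ∀ z ∈ L, z ∉ cthickening ε K ∧
      ¬ Bornology.IsBounded (connectedComponentIn (cthickening ε K)ᶜ z) := by
  have hmono : ∀ ε ε' : ℝ, ε ≤ ε' → (cthickening ε' K)ᶜ ⊆ (cthickening ε K)ᶜ := fun ε ε' h =>
    compl_subset_compl.2 (cthickening_mono h K)
  have hmem : ∀ ε ε' : ℝ, ε ≤ ε' → ∀ z, (z ∉ cthickening ε' K ∧
      ¬ Bornology.IsBounded (connectedComponentIn (cthickening ε' K)ᶜ z)) →
      (z ∉ cthickening ε K ∧ ¬ Bornology.IsBounded (connectedComponentIn (cthickening ε K)ᶜ z)) :=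
    fun ε ε' h z hz => ⟨hmono ε ε' h hz.1, fun hb => hz.2 (hb.subset
      (connectedComponentIn_mono z (hmono ε ε' h)))⟩
  obtain ⟨R, hR, hRsub, -⟩ :=
    (hK.cthickening (r := ε₀)).isPreconnected_setOf_not_isBounded
  set x₀ : ℂ := ((R + 1 : ℝ) : ℂ) with hx₀
  have hx₀R : R < ‖x₀‖ := by
    rw [hx₀, Complex.norm_real, Real.norm_of_nonneg (by linarith)]; linarith
  have hx₀K : x₀ ∈ Kᶜ := fun h => (hRsub hx₀R).1 (self_subset_cthickening K h)
  have hpath : IsPathConnected Kᶜ :=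
    (hK.isClosed.isOpen_compl.isConnected_iff_isPathConnected).1 ⟨⟨x₀, hx₀K⟩, hKc⟩
  refine hL.induction_on (p := fun L => ∃ ε > 0, ε ≤ ε₀ ∧ ∀ z ∈ L, z ∉ cthickening ε K ∧
    ¬ Bornology.IsBounded (connectedComponentIn (cthickening ε K)ᶜ z)) ⟨ε₀, hε₀, le_rfl, by simp⟩
    ?_ ?_ ?_
  · rintro s t hst ⟨ε, hε, hle, h⟩
    exact ⟨ε, hε, hle, fun z hz => h z (hst hz)⟩
  · rintro s t ⟨ε, hε, hle, h⟩ ⟨ε', hε', hle', h'⟩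
    refine ⟨min ε ε', lt_min hε hε', (min_le_left _ _).trans hle, fun z hz => ?_⟩
    rcases hz with hz | hz
    · exact hmem _ _ (min_le_left _ _) z (h z hz)
    · exact hmem _ _ (min_le_right _ _) z (h' z hz)
  · intro z hz
    obtain ⟨γ, hγ⟩ := hpath.joinedIn z (hLK hz) x₀ hx₀K
    have hdisj : Disjoint (range γ) K := disjoint_left.2 (by rintro _ ⟨t, rfl⟩; exact hγ t)
    obtain ⟨ε, hε, hd⟩ := hdisj.exists_cthickenings (isCompact_range γ.continuous) hK.isClosed
    set ε' := min ε ε₀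
    have hsub : range γ ⊆ (cthickening ε' K)ᶜ := fun y hy hyK =>
      disjoint_left.1 hd (self_subset_cthickening _ hy) (cthickening_mono (min_le_left _ _) K hyK)
    have hz' : z ∈ connectedComponentIn (cthickening ε' K)ᶜ x₀ :=
      (isPreconnected_range γ.continuous).subset_connectedComponentIn
        ⟨1, γ.target⟩ hsub ⟨0, γ.source⟩
    have hx₀' := hmem ε' ε₀ (min_le_right _ _) x₀ (hRsub hx₀R)
    refine ⟨connectedComponentIn (cthickening ε' K)ᶜ x₀, mem_nhdsWithin_of_mem_nhds ?_,
      ε', lt_min hε hε₀, min_le_right _ _, fun y hy => ⟨connectedComponentIn_subset _ _ hy, ?_⟩⟩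
    · exact isClosed_cthickening.isOpen_compl.connectedComponentIn.mem_nhds hz'
    · rw [← connectedComponentIn_eq hy]
      exact hx₀'.2

/-- If `h` is a superposition of the functions `w ↦ 1 / (z - w)` with `z` in unbounded components of
the complement of a compact set `K`, then `h` is a uniform limit of polynomials on `K`. -/
theorem exists_polynomial_norm_sub_le_of_integral {K : Set ℂ} (hK : IsCompact K) {b h : ℂ → ℂ}
    (hb : Continuous b) {L : Set ℂ} (hL : IsClosed L) (hbL : ∀ z ∉ L, b z = 0)
    (hLK : ∀ z ∈ L, z ∉ K ∧ ¬ Bornology.IsBounded (connectedComponentIn Kᶜ z)) {R : ℝ}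
    (hh : ∀ w ∈ K, h w = ∫ x in (-R)..R, ∫ y in (-R)..R,
      b (x + y * Complex.I) * ((x : ℂ) + y * Complex.I - w)⁻¹) {δ : ℝ} (hδ : 0 < δ) :
    ∃ P : Polynomial ℂ, ∀ w ∈ K, ‖P.eval w - h w‖ ≤ δ := by
  have : CompactSpace K := isCompact_iff_compactSpace.1 hK
  set A : Subalgebra ℂ C(K, ℂ) := (polynomialFunctions K).topologicalClosure with hA
  have hAc : IsClosed (A : Set C(K, ℂ)) := Subalgebra.isClosed_topologicalClosure _
  have : CompleteSpace A := hAc.completeSpace_coe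
  set X : A := ⟨Polynomial.toContinuousMapOnAlgHom K Polynomial.X,
    Subalgebra.le_topologicalClosure _ ⟨Polynomial.X, Algebra.mem_top, rfl⟩⟩ with hX
  have hXspec : spectrum ℂ (X : C(K, ℂ)) = K := by
    rw [ContinuousMap.spectrum_eq_range]
    ext z
    simp [hX]
  -- This replaces pole pushing: points of the spectrum in `A` outside `K` lie in bounded components
  -- of `Kᶜ`, so for `z ∈ L` the resolvent stays in `A`.
  have hres : ∀ z ∈ L, z ∉ spectrum ℂ X := fun z hz hs => by
    have := Subalgebra.spectrum_isBounded_connectedComponentIn A X hs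
    rw [hXspec] at this
    exact (hLK z hz).2 this
  set Ψ : ℂ → A := fun z => b z • Ring.inverse (algebraMap ℂ A z - X) with hΨ
  have hΨc : Continuous Ψ := by
    refine continuous_iff_continuousAt.2 fun z => ?_
    by_cases hz : z ∈ L
    · have hu : IsUnit (algebraMap ℂ A z - X) := spectrum.notMem_iff.1 (hres z hz)
      obtain ⟨u, hu⟩ := hu
      have h1 : ContinuousAt Ring.inverse (algebraMap ℂ A z - X) := hu ▸ NormedRing.inverse_continuousAt u
      exact hb.continuousAt.smul (h1.comp (f := fun z => algebraMap ℂ A z - X)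
        ((continuous_algebraMap ℂ A).sub continuous_const).continuousAt)
    · refine (continuousAt_const (y := (0 : A))).congr ?_
      filter_upwards [hL.isOpen_compl.mem_nhds hz] with y hy
      simp [hΨ, hbL y hy]
  -- The integral is taken in the Banach space `A`, so it is automatically a limit of polynomials.
  set J : A := ∫ x in (-R)..R, ∫ y in (-R)..R, Ψ (x + y * Complex.I) with hJ
  have hJe : ∀ w : K, (J : C(K, ℂ)) w = h w := fun w => by
    set ev : A →L[ℂ] ℂ := (ContinuousMap.evalCLM ℂ w).comp A.toSubmodule.subtypeL with hev
    have hevΨ : ∀ z, ev (Ψ z) = b z * (z - w)⁻¹ := fun z => by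
      by_cases hz : z ∈ L
      · have hu : IsUnit (algebraMap ℂ A z - X) := spectrum.notMem_iff.1 (hres z hz)
        have h1 := Ring.mul_inverse_cancel _ hu
        have h2 : (z - w) * ((Ring.inverse (algebraMap ℂ A z - X) : A) : C(K, ℂ)) w = 1 := by
          have := congrArg (fun F : A => (F : C(K, ℂ)) w) h1
          simpa [hX] using this
        have h3 : ev (Ψ z) = b z * ((Ring.inverse (algebraMap ℂ A z - X) : A) : C(K, ℂ)) w :=
          ev.map_smul _ _
        rw [h3, ← eq_inv_of_mul_eq_one_right h2]
      · simp [hΨ, hbL z hz]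
    have h1 : (J : C(K, ℂ)) w = ev J := rfl
    rw [h1, hh w w.2, hJ]
    have hc1 : ∀ x : ℝ, Continuous fun y : ℝ => Ψ (x + y * Complex.I) := fun x => by fun_prop
    have hc2 : Continuous fun x : ℝ => ∫ y in (-R)..R, Ψ (x + y * Complex.I) :=
      intervalIntegral.continuous_parametric_intervalIntegral_of_continuous' (by fun_prop) _ _
    rw [← ev.intervalIntegral_comp_comm (hc2.intervalIntegrable _ _)]
    congr 1 with x
    rw [← ev.intervalIntegral_comp_comm ((hc1 x).intervalIntegrable _ _)]
    simp only [hevΨ]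
  have hJA : (J : C(K, ℂ)) ∈ closure (polynomialFunctions K : Set C(K, ℂ)) := J.2
  obtain ⟨_, ⟨P, -, rfl⟩, hP⟩ := Metric.mem_closure_iff.1 hJA δ hδ
  refine ⟨P, fun w hw => ?_⟩
  have h1 := (ContinuousMap.dist_apply_le_dist (f := (J : C(K, ℂ))) (g := _) ⟨w, hw⟩).trans hP.le
  rw [hJe, dist_comm, dist_eq_norm] at h1
  simpa using h1

/-- **Runge's theorem** for compact sets with connected complement, with approximation on a
neighbourhood of the compact set. -/
theorem AnalyticOnNhd.exists_cthickening_polynomial_norm_sub_le {K : Set ℂ} (hK : IsCompact K)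
    (hKc : IsPreconnected Kᶜ) {h : ℂ → ℂ} (hh : AnalyticOnNhd ℂ h K) :
    ∃ ε > 0, ∀ δ > 0, ∃ P : Polynomial ℂ, ∀ z ∈ cthickening ε K, ‖P.eval z - h z‖ ≤ δ := by
  obtain ⟨R, hR, hKR⟩ := hK.isBounded.subset_ball_lt 0 0
  set W : Set ℂ := {z | AnalyticAt ℂ h z} ∩ ball 0 R with hW
  have hWo : IsOpen W := (isOpen_analyticAt ℂ h).inter isOpen_ball
  have hKW : K ⊆ W := fun z hz => ⟨hh z hz, hKR hz⟩
  obtain ⟨χ, hχ0, hχ1, -⟩ := exists_contMDiffMap_zero_one_nhds_of_isClosed (n := 1)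
    (modelWithCornersSelf ℝ ℂ) hWo.isClosed_compl hK.isClosed
    (disjoint_left.2 fun z hz hzK => hz (hKW hzK))
  have hχ : ContDiff ℝ 1 χ := χ.contMDiff.contDiff
  rw [eventually_nhdsSet_iff_forall] at hχ0 hχ1
  set F : ℂ → ℂ := fun z => χ z • h z with hF
  have hF0 : ∀ z ∉ W, ∀ᶠ y in 𝓝 z, F y = 0 := fun z hz => by
    filter_upwards [hχ0 z hz] with y hy
    simp [hF, hy]
  have hFc : ContDiff ℝ 1 F := by
    refine contDiff_iff_contDiffAt.2 fun z => ?_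
    by_cases hz : z ∈ W
    · exact hχ.contDiffAt.smul (hz.1.contDiffAt.restrict_scalars ℝ)
    · exact (contDiffAt_const (c := (0 : ℂ))).congr_of_eventuallyEq (hF0 z hz)
  set O : Set ℂ := {z | ∀ᶠ y in 𝓝 z, χ y = 1} ∩ W with hO
  have hOo : IsOpen O := isOpen_setOfPred_eventually_nhds.inter hWo
  have hKO : K ⊆ O := fun z hz => ⟨hχ1 z hz, hKW hz⟩
  have hFO : ∀ z ∈ O, AnalyticAt ℂ F z := fun z hz => by
    refine hz.2.1.congr ?_
    filter_upwards [hz.1] with y hy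
    simp [hF, hy]
  obtain ⟨ε₀, hε₀, hε₀O⟩ := hK.exists_cthickening_subset_open hOo hKO
  -- `dbar F` vanishes off this set: `F` is analytic on `O` and zero near every point outside `W`.
  have hLc : IsCompact (closedBall (0 : ℂ) R ∩ Oᶜ) :=
    (isCompact_closedBall 0 R).inter_right hOo.isClosed_compl
  obtain ⟨ε, hε, hle, hL⟩ := hK.exists_cthickening_not_isBounded hKc hLc
    (fun z hz hzK => hz.2 (hKO hzK)) hε₀
  refine ⟨ε, hε, fun δ hδ => ?_⟩
  set c : ℂ := -(2 * Real.pi * Complex.I) with hc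
  have hc0 : c ≠ 0 := neg_ne_zero.2 Complex.two_pi_I_ne_zero
  have hKO' : cthickening ε K ⊆ O := (cthickening_mono hle K).trans hε₀O
  refine exists_polynomial_norm_sub_le_of_integral hK.cthickening (b := fun z => c⁻¹ * dbar F z)
    (continuous_const.mul hFc.continuous_dbar) hLc.isClosed (fun z hz => ?_) hL (R := R)
    (fun w hw => ?_) hδ
  · have : dbar F z = 0 := by
      by_cases hzO : z ∈ O
      · exact (hFO z hzO).differentiableAt.dbar_eq_zero
      · refine DifferentiableAt.dbar_eq_zero ?_
        refine (differentiableAt_const (0 : ℂ)).congr_of_eventuallyEq (hF0 z fun hzW => hz ⟨?_, hzO⟩)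
        exact ball_subset_closedBall hzW.2
    simp [this]
  · have hwO := hKO' hw
    have hwR : ‖w‖ < R := mem_ball_zero_iff.1 hwO.2.2
    have key := integral_dbar_mul_sub_inv hFc (R := R) (w := w) (fun z hz => by
        have hzR : ‖z‖ < R := by
          by_contra hzR
          exact hz ((hF0 z fun hzW => hzR (mem_ball_zero_iff.1 hzW.2)).self_of_nhds)
        exact ⟨(Complex.abs_re_le_norm z).trans_lt hzR, (Complex.abs_im_le_norm z).trans_lt hzR⟩)
      ((Complex.abs_re_le_norm w).trans_lt hwR) ((Complex.abs_im_le_norm w).trans_lt hwR) (hFO w hwO)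
    have hFw : F w = h w := by simp [hF, hwO.1.self_of_nhds]
    simp only [mul_assoc c⁻¹, intervalIntegral.integral_const_mul, key, hFw]
    rw [hc] at hc0 ⊢
    field_simp

/-! ### Conclusion -/

theorem mainTheorem1 (D : Set ℂ) (hD : IsJordanDomain D) (f : ℂ → ℂ)
    (hf : AnalyticOnNhd ℂ f (closure D)) :
    ∃ (p : Polynomial ℂ) (φ : ℂ → ℂ),
      AnalyticOnNhd ℂ φ D ∧ Set.InjOn φ D ∧ ∀ z ∈ D, f z = p.eval (φ z) := by
  have hK : IsCompact (closure D) := hD.isBounded.isCompact_closure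
  have hKc := hD.isPreconnected_compl_closure
  obtain ⟨hDo, hDc, -⟩ := hD
  by_cases h0 : ∀ z ∈ closure D, ¬ ∀ᶠ w in 𝓝 z, deriv f w = 0
  · obtain ⟨s, g, hg, hg0, hfac⟩ := hf.deriv.exists_factor hK h0
    -- Doubling the multiset interpolates along `q²`.
    obtain ⟨T, h, hh, hT⟩ := hf.exists_polynomial_add_mul (s + s)
    simp only [Multiset.map_add, Multiset.prod_add, ← pow_two, Polynomial.eval_pow] at hT
    obtain ⟨ε, hε, happ⟩ := hh.exists_cthickening_polynomial_norm_sub_le hK hKc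
    obtain ⟨p, φ, hφ, hinj, hp⟩ := exists_polynomial_comp_eq_of_approx hK
      (Polynomial.monic_multiset_prod_of_monic s _ fun a _ => Polynomial.monic_X_sub_C a).ne_zero
      hf hg hh hg0 hfac hT hε happ
    exact ⟨p, φ, hφ.mono subset_closure, hinj.mono subset_closure,
      fun z hz => hp z (subset_closure hz)⟩
  · push Not at h0
    obtain ⟨z, hz, hz0⟩ := h0
    have hder : EqOn (deriv f) 0 D :=
      (hf.deriv.eqOn_zero_of_preconnected_of_eventuallyEq_zero hDc.closure.isPreconnected hz
        hz0).mono subset_closure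
    obtain ⟨c, hc⟩ := hDo.exists_is_const_of_deriv_eq_zero hDc.isPreconnected
      (hf.mono subset_closure).differentiableOn hder
    exact ⟨Polynomial.C c, id, fun _ _ => analyticAt_id, injOn_id D, fun z hz => by
      rw [Polynomial.eval_C, hc z hz]⟩
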